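/- Let $G$ be a group generated by a finite family $A=\{a_i\}$, let $S=A\cup A^{-1}$ be the alphabet of generators and formal inverses, $\pi:S^*\to G$ the canonical projection, and $d_A$ the word metric. A language $L\subseteq S^*$ is a normal form of $G$ if $\pi|_L:L\to G$ is a bijection; it is quasigeodesic if for some $C>0$ one has $|w|\le C(d_A(e,\pi(w))+1)$ for all $w\in L$. A Cayley automatic representation of $G$ is a bijection $\psi:L\to G$ from a regular language $L\subseteq S^*$ such that for every $a\in A$ the relation $\{(u_1,u_2)\in L\times L:\psi(u_1)a=\psi(u_2)\}$ is recognized by a two-tape synchronous automaton; $G$ is automatic if for some $L$ the map $\psi=\pi|_L$ is such a representation. The Cayley distance function of $\psi$ is $h(n)=\max\{d_A(\psi(w),\pi(w)): w\in L,\ |w|\le n\}$, with $h(n)=0$ if there is no such $w$. For nondecreasing nonnegative functions write $h\preceq f$ if there are positive integers $K,M$ such that $h(n)\le Kf(Mn)$ for all sufficiently large integers $n$, and $h\ll f$ if $ht\preceq f$ for some unbounded nondecreasing $t:\{N,N+1,\dots\}\to[0,\infty)$. For a nondecreasing nonnegative $f\ll n$, a normal form $L'$ has the $f(n)$-fellow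 traveler property if $s\preceq f$, where $$s(n)=\max\{d_A(\pi(w_1(t)),\pi(w_2(t))): t\le n,\ w_1,w_2\in L',\ a\in A,\ \pi(w_1)a=\pi(w_2)\}$$ and $w(t)$ is the prefix of $w$ of length $t$ (all of $w$ if $t>|w|$), with $s(n)=0$ if there are no such $w_1,w_2,a$. Theorem. Suppose that $G$ is not automatic and has a Cayley automatic representation $\psi:L\to G$ whose Cayley distance function satisfies $h\ll n$. Then $G$ has a quasigeodesic normal form $L'\subseteq S^*$ with the $h(n)$-fellow traveler property. More precisely, for each $u\in L$ one can choose a word $v(u)\in S^*$ labelling a geodesic from $\pi(u)$ to $\psi(u)$ in the Cayley graph, that is, $\pi(u\,v(u))=\psi(u)$ and $|v(u)|=d_A(\pi(u),\psi(u))$; and for every such choice the language $L'=\{u\,v(u): u\in L\}$ is a quasigeodesic normal form of $G$ with the $h(n)$-fellow traveler property. -/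

import Mathlib

/-!
Conventions. A finite generating set `A = {a_i}` of a group `G` (repetitions and the identity are
allowed) is a family `a : ι → G` indexed by a finite type `ι`.  The alphabet `S = A ∪ A⁻¹` of
generators and formal inverses is `ι × Bool`: `(i, true)` stands for `a i` and `(i, false)` for the
formal inverse of `a i`.  Words are lists over this alphabet.
-/

namespace FellowTraveler

/-- The alphabet `S` of generators `(i, true)` and formal inverses `(i, false)`. -/
abbrev Letter (ι : Type*) : Type _ := ι × Bool

section Group

variable {ι G : Type*} [Group G]

/-- The group element represented by a letter. -/
def letterVal (a : ι → G) (s : Letter ι) : G := if s.2 then a s.1 else (a s.1)⁻¹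

/-- The canonical projection `π : S* → G`. -/
def proj (a : ι → G) (w : List (Letter ι)) : G := (w.map (letterVal a)).prod

/-- The word metric `d_A (g₁, g₂)`: the least length of a word representing `g₁⁻¹ g₂`. -/
noncomputable def wordDist (a : ι → G) (g₁ g₂ : G) : ℕ :=
  sInf {n | ∃ w : List (Letter ι), proj a w = g₁⁻¹ * g₂ ∧ w.length = n}

/-- `L` is a (one-to-one) normal form of `G`: `π` restricts to a bijection from `L` onto `G`. -/
def IsNormalForm (a : ι → G) (L : Language (Letter ι)) : Prop :=
  Set.BijOn (proj a) {w | w ∈ L} Set.univ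

end Group

/-- A binary relation on words is recognized by a two-tape synchronous automaton: the shorter of the
two words is padded at its end with a padding symbol (`none`), and the language of the resulting
words of pairs is recognized by a finite automaton. -/
def SyncRecognizable {α : Type*} (R : List α → List α → Prop) : Prop :=
  Language.IsRegular
    ({p | ∃ u v : List α, R u v ∧ p = List.zipWithAll Prod.mk u v} :
      Language (Option α × Option α))

section Group

variable {ι G : Type*} [Group G]

/-- `ψ` is a Cayley automatic representation `L → G` over the generators `a`: it is a bijection from
the regular language `L` onto `G`, and right multiplication by each generator is recognized by a
two-tape synchronous automaton.  Only the values of `ψ` on `L` matter. -/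
structure IsCayleyAutomaticRep (a : ι → G) (L : Language (Letter ι))
    (ψ : List (Letter ι) → G) : Prop where
  bijOn : Set.BijOn ψ {w | w ∈ L} Set.univ
  regular : L.IsRegular
  recognizable : ∀ i : ι, SyncRecognizable fun u v => u ∈ L ∧ v ∈ L ∧ ψ u * a i = ψ v

/-- `G` is automatic (with respect to the generators `a`): some regular normal form `L` of `G` has
multiplication by each generator recognized by a two-tape synchronous automaton; that is, the
canonical projection `π : L → G` is a Cayley automatic representation. -/
def IsAutomatic (a : ι → G) : Prop :=
  ∃ L : Language (Letter ι), IsCayleyAutomaticRep a L (proj a)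

/-- The Cayley distance function `h(n) = max {d_A (ψ(w), π(w)) | w ∈ L, |w| ≤ n}`, which is `0` if
there is no such `w`.  The supremum in `ℕ` of the empty set is `0`; as the alphabet is finite, it is
a maximum otherwise. -/
noncomputable def cayleyDistance (a : ι → G) (L : Language (Letter ι))
    (ψ : List (Letter ι) → G) (n : ℕ) : ℝ :=
  ((sSup {d | ∃ w ∈ L, w.length ≤ n ∧ d = wordDist a (ψ w) (proj a w)} : ℕ) : ℝ)

/-- The function `s(n)`: the maximum of `d_A (π(w₁(t)), π(w₂(t)))` over `t ≤ n`, `w₁, w₂ ∈ L` and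
generators `a i` with `π(w₁) a i = π(w₂)`, where `w(t)` is the prefix of `w` of length `t` (all of
`w` if `t > |w|`).  These distances are at most `2n`. -/
noncomputable def fellowDist (a : ι → G) (L : Language (Letter ι)) (n : ℕ) : ℝ :=
  ((sSup {d | ∃ t ≤ n, ∃ w₁ ∈ L, ∃ w₂ ∈ L, ∃ i : ι, proj a w₁ * a i = proj a w₂ ∧
    d = wordDist a (proj a (w₁.take t)) (proj a (w₂.take t))} : ℕ) : ℝ)

/-- A normal form is quasigeodesic: `|w| ≤ C (d_A (e, π(w)) + 1)` on `L` for some `C > 0`. -/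
def IsQuasigeodesic (a : ι → G) (L : Language (Letter ι)) : Prop :=
  ∃ C : ℝ, 0 < C ∧ ∀ w ∈ L, (w.length : ℝ) ≤ C * ((wordDist a 1 (proj a w) : ℝ) + 1)

end Group

/-- `h ≼ f`: there are positive integers `K, M` with `h(n) ≤ K f(M n)` for all large `n`. -/
def CoarseLE (h f : ℕ → ℝ) : Prop :=
  ∃ K M N : ℕ, 0 < K ∧ 0 < M ∧ ∀ n, N ≤ n → h n ≤ (K : ℝ) * f (M * n)

/-- `h ≪ f`: there is an unbounded nondecreasing `t : [N, ∞) → [0, ∞)` with `h t ≼ f`. -/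
def MuchLess (h f : ℕ → ℝ) : Prop :=
  ∃ (N : ℕ) (t : ℕ → ℝ), MonotoneOn t (Set.Ici N) ∧ (∀ n, N ≤ n → 0 ≤ t n) ∧
    (∀ B : ℝ, ∃ n, N ≤ n ∧ B < t n) ∧ CoarseLE (fun n => h n * t n) f

/-- The identity function on `ℕ`, real valued. -/
def idFun (n : ℕ) : ℝ := (n : ℝ)

section Group

variable {ι G : Type*} [Group G]

/-- The `f(n)`-fellow traveler property of `L`: `f` is a nondecreasing nonnegative function with
`f ≪ n`, and `s ≼ f`. -/
structure FellowTravelerProperty (a : ι → G) (L : Language (Letter ι)) (f : ℕ → ℝ) : Prop where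
  monotone : Monotone f
  nonneg : ∀ n, 0 ≤ f n
  muchLess : MuchLess f idFun
  fellowDist_le : CoarseLE (fellowDist a L) f

/-- `v` chooses, for each `u ∈ L`, the label `v u` of a geodesic from `π(u)` to `ψ(u)` in the Cayley
graph: `π(u (v u)) = ψ(u)` and `|v u| = d_A (π(u), ψ(u))`. -/
def IsGeodesicChoice (a : ι → G) (L : Language (Letter ι)) (ψ : List (Letter ι) → G)
    (v : List (Letter ι) → List (Letter ι)) : Prop :=
  ∀ u ∈ L, proj a (u ++ v u) = ψ u ∧ (v u).length = wordDist a (proj a u) (ψ u)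

end Group

/-- The language `{u (v u) | u ∈ L}`. -/
def appendLanguage {α : Type*} (L : Language α) (v : List α → List α) : Language α :=
  {w | ∃ u ∈ L, w = u ++ v u}

end FellowTraveler

/-! A finite automaton can finish any accepted run within a bounded number `c` of letters. So if
`u₁, u₂ ∈ L` represent neighbours under `ψ`, their prefixes of length `t` extend by at most `c`
letters to another such pair. The extended words have length at most `t + c`, so `π` and `ψ` differ
on them by at most `h(t + c)`, and the prefixes are within `2h(t + c) + 2c + 1` under `π`. Appending
geodesics moves prefixes by at most `h(t)`. Since `G` is not automatic, `h` is eventually at least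
`1` and absorbs the additive constant. The same completion, cut at the end of one word, shows that
lengths of neighbouring representatives differ boundedly. Hence `|u|` is linear in the distance from
`1` to `ψ u`, which gives quasigeodesicity. -/

namespace FellowTraveler

/-! ### Bounded completions in regular languages and synchronous relations -/

section Automata

variable {α : Type*}

/-- In a regular language, every suffix with property `P` can be replaced by one of bounded length
with property `P`. -/
theorem exists_bounded_completion {K : Language α} (hK : K.IsRegular) (P : List α → Prop) :
    ∃ c : ℕ, ∀ p y : List α, p ++ y ∈ K → P y → ∃ x, p ++ x ∈ K ∧ P x ∧ x.length ≤ c := by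
  classical
  obtain ⟨σ, _, M, rfl⟩ := hK
  -- Whether a suffix completes `p` depends only on the state reached by `p`; with finitely many
  -- states, one witness per state suffices.
  have key : ∀ q : σ, ∃ n : ℕ, (∃ y, M.evalFrom q y ∈ M.accept ∧ P y) →
      ∃ x, M.evalFrom q x ∈ M.accept ∧ P x ∧ x.length ≤ n := by
    intro q
    by_cases h : ∃ y, M.evalFrom q y ∈ M.accept ∧ P y
    · obtain ⟨y, h1, h2⟩ := h
      exact ⟨y.length, fun _ => ⟨y, h1, h2, le_rfl⟩⟩
    · exact ⟨0, fun h' => absurd h' h⟩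
  choose n hn using key
  refine ⟨Finset.univ.sup n, fun p y hpy hy => ?_⟩
  have split : ∀ z, p ++ z ∈ M.accepts ↔ M.evalFrom (M.evalFrom M.start p) z ∈ M.accept := by
    intro z
    rw [DFA.mem_accepts, DFA.eval, DFA.evalFrom_of_append]
  obtain ⟨x, h1, h2, h3⟩ := hn (M.evalFrom M.start p) ⟨y, (split y).1 hpy, hy⟩
  exact ⟨x, (split x).2 h1, h2, h3.trans (Finset.le_sup (f := n) (Finset.mem_univ _))⟩

/-- Padding occurs only at the end of a tape, so discarding `none` recovers the tape and commutes
with taking prefixes. -/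
theorem filterMap_fst_take_zipWithAll (u v : List α) (t : ℕ) :
    ((List.zipWithAll Prod.mk u v).take t).filterMap Prod.fst = u.take t := by
  induction u generalizing v t with
  | nil => simp [← List.map_take, List.filterMap_map]
  | cons x u ih =>
    cases t with
    | zero => simp
    | succ t =>
      cases v with
      | nil => simp [← List.map_take, List.filterMap_map]
      | cons y v => simp [ih]

theorem filterMap_snd_take_zipWithAll (u v : List α) (t : ℕ) :
    ((List.zipWithAll Prod.mk u v).take t).filterMap Prod.snd = v.take t := by
  induction u generalizing v t with
  | nil => simp [← List.map_take, List.filterMap_map]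
  | cons x u ih =>
    cases t with
    | zero => simp
    | succ t =>
      cases v with
      | nil => simp [← List.map_take, List.filterMap_map]
      | cons y v => simp [ih]

theorem filterMap_fst_zipWithAll (u v : List α) :
    (List.zipWithAll Prod.mk u v).filterMap Prod.fst = u := by
  induction u generalizing v with
  | nil => simp [List.filterMap_map]
  | cons x u ih =>
    cases v with
    | nil => simp [List.filterMap_map]
    | cons y v => simp [ih]

theorem filterMap_snd_zipWithAll (u v : List α) :
    (List.zipWithAll Prod.mk u v).filterMap Prod.snd = v := by
  induction u generalizing v with
  | nil => simp [List.filterMap_map]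
  | cons x u ih =>
    cases v with
    | nil => simp [List.filterMap_map]
    | cons y v => simp [ih]

theorem filterMap_fst_drop_zipWithAll (u v : List α) (t : ℕ) :
    ((List.zipWithAll Prod.mk u v).drop t).filterMap Prod.fst = u.drop t := by
  have h := filterMap_fst_zipWithAll u v
  rw [← List.take_append_drop t (List.zipWithAll Prod.mk u v), List.filterMap_append,
    filterMap_fst_take_zipWithAll] at h
  exact List.append_cancel_left (h.trans (List.take_append_drop t u).symm)

theorem filterMap_snd_drop_zipWithAll (u v : List α) (t : ℕ) :
    ((List.zipWithAll Prod.mk u v).drop t).filterMap Prod.snd = v.drop t := by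
  have h := filterMap_snd_zipWithAll u v
  rw [← List.take_append_drop t (List.zipWithAll Prod.mk u v), List.filterMap_append,
    filterMap_snd_take_zipWithAll] at h
  exact List.append_cancel_left (h.trans (List.take_append_drop t v).symm)

/-- In a synchronously recognizable relation, the suffixes of a related pair after position `t` can
be replaced by suffixes of bounded length, keeping empty suffixes empty. -/
theorem SyncRecognizable.exists_bounded_completion {R : List α → List α → Prop}
    (hR : SyncRecognizable R) :
    ∃ c : ℕ, ∀ u v, R u v → ∀ t : ℕ, ∃ p q : List α, R (u.take t ++ p) (v.take t ++ q) ∧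
      p.length ≤ c ∧ q.length ≤ c ∧ (u.drop t = [] → p = []) ∧ (v.drop t = [] → q = []) := by
  -- The completion constant depends on the property preserved. Recording which tapes are exhausted
  -- at `t` by `b₁, b₂` leaves four properties, hence a common maximum.
  have key : ∀ b₁ b₂ : Prop, ∃ c : ℕ, ∀ u v, R u v → ∀ t : ℕ, (b₁ → u.drop t = []) →
      (b₂ → v.drop t = []) → ∃ p q : List α, R (u.take t ++ p) (v.take t ++ q) ∧
      p.length ≤ c ∧ q.length ≤ c ∧ (b₁ → p = []) ∧ (b₂ → q = []) := by
    intro b₁ b₂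
    obtain ⟨c, hc⟩ := FellowTraveler.exists_bounded_completion hR
      (fun x => (b₁ → x.filterMap Prod.fst = []) ∧ (b₂ → x.filterMap Prod.snd = []))
    refine ⟨c, fun u v huv t h₁ h₂ => ?_⟩
    obtain ⟨x, ⟨u', v', huv', hx⟩, ⟨hx₁, hx₂⟩, hxc⟩ := hc
      ((List.zipWithAll Prod.mk u v).take t) ((List.zipWithAll Prod.mk u v).drop t)
      (by rw [List.take_append_drop]; exact ⟨u, v, huv, rfl⟩)
      ⟨by rwa [filterMap_fst_drop_zipWithAll], by rwa [filterMap_snd_drop_zipWithAll]⟩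
    have hu := congrArg (List.filterMap Prod.fst) hx
    have hv := congrArg (List.filterMap Prod.snd) hx
    rw [List.filterMap_append, filterMap_fst_take_zipWithAll, filterMap_fst_zipWithAll] at hu
    rw [List.filterMap_append, filterMap_snd_take_zipWithAll, filterMap_snd_zipWithAll] at hv
    exact ⟨x.filterMap Prod.fst, x.filterMap Prod.snd, by rwa [hu, hv],
      (List.length_filterMap_le _ _).trans hxc, (List.length_filterMap_le _ _).trans hxc, hx₁, hx₂⟩
  choose c hc using key
  refine ⟨max (max (c True True) (c True False)) (max (c False True) (c False False)),
    fun u v huv t => ?_⟩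
  by_cases h₁ : u.drop t = [] <;> by_cases h₂ : v.drop t = []
  · obtain ⟨p, q, h, hp, hq, hp', hq'⟩ := hc True True u v huv t (fun _ => h₁) (fun _ => h₂)
    exact ⟨p, q, h, by omega, by omega, fun _ => hp' trivial, fun _ => hq' trivial⟩
  · obtain ⟨p, q, h, hp, hq, hp', -⟩ := hc True False u v huv t (fun _ => h₁) False.elim
    exact ⟨p, q, h, by omega, by omega, fun _ => hp' trivial, fun h => absurd h h₂⟩
  · obtain ⟨p, q, h, hp, hq, -, hq'⟩ := hc False True u v huv t False.elim (fun _ => h₂)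
    exact ⟨p, q, h, by omega, by omega, fun h => absurd h h₁, fun _ => hq' trivial⟩
  · obtain ⟨p, q, h, hp, hq, -, -⟩ := hc False False u v huv t False.elim False.elim
    exact ⟨p, q, h, by omega, by omega, fun h => absurd h h₁, fun h => absurd h h₂⟩

end Automata

/-! ### The word metric -/

section WordMetric

variable {ι G : Type*} [Group G] {a : ι → G}

@[simp] theorem proj_nil : proj a [] = 1 := rfl

theorem proj_append (u v : List (Letter ι)) : proj a (u ++ v) = proj a u * proj a v := by
  simp [proj]

theorem proj_singleton (s : Letter ι) : proj a [s] = letterVal a s := by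
  simp [proj]

theorem proj_cons (s : Letter ι) (w : List (Letter ι)) :
    proj a (s :: w) = letterVal a s * proj a w := by
  simp [proj]

theorem exists_proj_inv (w : List (Letter ι)) :
    ∃ w' : List (Letter ι), proj a w' = (proj a w)⁻¹ ∧ w'.length = w.length := by
  induction w with
  | nil => exact ⟨[], by simp, rfl⟩
  | cons s w ih =>
    obtain ⟨w', h₁, h₂⟩ := ih
    refine ⟨w' ++ [(s.1, !s.2)], ?_, by simp [h₂]⟩
    rw [proj_append, proj_singleton, proj_cons, h₁, mul_inv_rev]
    obtain ⟨i, b⟩ := s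
    cases b <;> simp [letterVal]

theorem exists_proj_eq (hgen : Subgroup.closure (Set.range a) = ⊤) (g : G) :
    ∃ w, proj a w = g := by
  have hg : g ∈ Subgroup.closure (Set.range a) := hgen ▸ Subgroup.mem_top g
  induction hg using Subgroup.closure_induction with
  | mem x hx =>
    obtain ⟨i, rfl⟩ := hx
    exact ⟨[(i, true)], by simp [proj_singleton, letterVal]⟩
  | one => exact ⟨[], proj_nil⟩
  | mul x y _ _ hx hy =>
    obtain ⟨u, rfl⟩ := hx
    obtain ⟨v, rfl⟩ := hy
    exact ⟨u ++ v, proj_append u v⟩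
  | inv x _ hx =>
    obtain ⟨u, rfl⟩ := hx
    obtain ⟨w, hw, -⟩ := exists_proj_inv (a := a) u
    exact ⟨w, hw⟩

theorem exists_geodesic (hgen : Subgroup.closure (Set.range a) = ⊤) (g₁ g₂ : G) :
    ∃ w, proj a w = g₁⁻¹ * g₂ ∧ w.length = wordDist a g₁ g₂ := by
  obtain ⟨w, hw⟩ := exists_proj_eq hgen (g₁⁻¹ * g₂)
  exact Nat.sInf_mem (s := {n | ∃ w : List (Letter ι), proj a w = g₁⁻¹ * g₂ ∧ w.length = n})
    ⟨w.length, w, hw, rfl⟩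

theorem wordDist_le_length {g₁ g₂ : G} {w : List (Letter ι)} (hw : g₁ * proj a w = g₂) :
    wordDist a g₁ g₂ ≤ w.length :=
  Nat.sInf_le ⟨w, eq_inv_mul_of_mul_eq hw, rfl⟩

theorem wordDist_triangle (hgen : Subgroup.closure (Set.range a) = ⊤) (x y z : G) :
    wordDist a x z ≤ wordDist a x y + wordDist a y z := by
  obtain ⟨u, hu, hu'⟩ := exists_geodesic hgen x y
  obtain ⟨v, hv, hv'⟩ := exists_geodesic hgen y z
  rw [← hu', ← hv', ← List.length_append]
  exact wordDist_le_length (by rw [proj_append, hu, hv]; group)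

theorem wordDist_comm (hgen : Subgroup.closure (Set.range a) = ⊤) (x y : G) :
    wordDist a x y = wordDist a y x := by
  have key : ∀ x y : G, wordDist a y x ≤ wordDist a x y := by
    intro x y
    obtain ⟨u, hu, hu'⟩ := exists_geodesic hgen x y
    obtain ⟨v, hv, hv'⟩ := exists_proj_inv (a := a) u
    rw [← hu', ← hv']
    exact wordDist_le_length (by rw [hv, hu]; group)
  exact le_antisymm (key y x) (key x y)

theorem eq_of_wordDist_eq_zero (hgen : Subgroup.closure (Set.range a) = ⊤) {x y : G}
    (h : wordDist a x y = 0) : x = y := by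
  obtain ⟨u, hu, hu'⟩ := exists_geodesic hgen x y
  rw [h, List.length_eq_zero_iff] at hu'
  subst hu'
  exact inv_mul_eq_one.1 hu.symm

theorem wordDist_mul_gen_le (x : G) (i : ι) : wordDist a x (x * a i) ≤ 1 :=
  wordDist_le_length (w := [(i, true)]) (by simp [proj_singleton, letterVal])

theorem exists_isGeodesicChoice (hgen : Subgroup.closure (Set.range a) = ⊤)
    (L : Language (Letter ι)) (ψ : List (Letter ι) → G) : ∃ v, IsGeodesicChoice a L ψ v := by
  choose v hv hv' using fun u => exists_geodesic hgen (proj a u) (ψ u)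
  exact ⟨v, fun u _ => ⟨by rw [proj_append, hv]; group, hv' u⟩⟩

end WordMetric

/-! ### The Cayley distance function -/

section CayleyDistance

variable {ι G : Type*} [Group G] {a : ι → G} {L : Language (Letter ι)}
  {ψ : List (Letter ι) → G}

theorem cayleyDistance_nonneg (n : ℕ) : 0 ≤ cayleyDistance a L ψ n := Nat.cast_nonneg _

variable [Finite ι]

theorem bddAbove_cayleyDistance (a : ι → G) (L : Language (Letter ι)) (ψ : List (Letter ι) → G)
    (n : ℕ) : BddAbove {d | ∃ w ∈ L, w.length ≤ n ∧ d = wordDist a (ψ w) (proj a w)} := by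
  refine (((List.finite_length_le (Letter ι) n).image
    fun w => wordDist a (ψ w) (proj a w)).subset ?_).bddAbove
  rintro d ⟨w, -, hw, rfl⟩
  exact ⟨w, hw, rfl⟩

theorem wordDist_le_cayleyDistance {w : List (Letter ι)} (hw : w ∈ L) {n : ℕ}
    (hn : w.length ≤ n) : (wordDist a (ψ w) (proj a w) : ℝ) ≤ cayleyDistance a L ψ n :=
  Nat.cast_le.2 (le_csSup (bddAbove_cayleyDistance a L ψ n) ⟨w, hw, hn, rfl⟩)

theorem cayleyDistance_mono : Monotone (cayleyDistance a L ψ) := by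
  intro m n hmn
  refine Nat.cast_le.2 (csSup_le' ?_)
  rintro d ⟨w, hw, hm, rfl⟩
  exact le_csSup (bddAbove_cayleyDistance a L ψ n) ⟨w, hw, hm.trans hmn, rfl⟩

/-- If `G` is not automatic, then the Cayley distance function does not vanish identically. -/
theorem exists_one_le_cayleyDistance (hgen : Subgroup.closure (Set.range a) = ⊤)
    (hnonauto : ¬ IsAutomatic a) (hψ : IsCayleyAutomaticRep a L ψ) :
    ∃ n, 1 ≤ cayleyDistance a L ψ n := by
  -- An integer-valued `h` below `1` is zero, which forces `ψ = π` on `L` and makes `G` automatic.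
  by_contra! h
  have heq : ∀ w ∈ L, ψ w = proj a w := by
    intro w hw
    have h' := (wordDist_le_cayleyDistance (a := a) (ψ := ψ) hw le_rfl).trans_lt (h w.length)
    exact eq_of_wordDist_eq_zero hgen (Nat.lt_one_iff.1 (by exact_mod_cast h'))
  refine hnonauto ⟨L, hψ.bijOn.congr heq, hψ.regular, fun i => ?_⟩
  have hR : (fun u v => u ∈ L ∧ v ∈ L ∧ proj a u * a i = proj a v) =
      fun u v => u ∈ L ∧ v ∈ L ∧ ψ u * a i = ψ v := by
    funext u v
    refine propext (and_congr_right fun hu => and_congr_right fun hv => ?_)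
    rw [heq u hu, heq v hv]
  rw [hR]
  exact hψ.recognizable i

end CayleyDistance

/-! ### Normal form, quasigeodesicity and fellow travelling -/

namespace IsCayleyAutomaticRep

variable {ι G : Type*} [Group G] {a : ι → G} {L : Language (Letter ι)}
  {ψ : List (Letter ι) → G} {v : List (Letter ι) → List (Letter ι)}

theorem isNormalForm_appendLanguage (hψ : IsCayleyAutomaticRep a L ψ)
    (hv : IsGeodesicChoice a L ψ v) : IsNormalForm a (appendLanguage L v) := by
  refine ⟨fun _ _ => Set.mem_univ _, ?_, ?_⟩
  · rintro _ ⟨u₁, hu₁, rfl⟩ _ ⟨u₂, hu₂, rfl⟩ h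
    rw [(hv u₁ hu₁).1, (hv u₂ hu₂).1] at h
    rw [hψ.bijOn.injOn hu₁ hu₂ h]
  · intro g _
    obtain ⟨u, hu, rfl⟩ := hψ.bijOn.surjOn (Set.mem_univ g)
    exact ⟨u ++ v u, ⟨u, hu, rfl⟩, (hv u hu).1⟩

variable [Finite ι]

theorem exists_bounded_completion (hψ : IsCayleyAutomaticRep a L ψ) :
    ∃ c : ℕ, ∀ i, ∀ u ∈ L, ∀ v ∈ L, ψ u * a i = ψ v → ∀ t : ℕ, ∃ p q : List (Letter ι),
      (u.take t ++ p ∈ L ∧ v.take t ++ q ∈ L ∧ ψ (u.take t ++ p) * a i = ψ (v.take t ++ q)) ∧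
      p.length ≤ c ∧ q.length ≤ c ∧ (u.drop t = [] → p = []) ∧ (v.drop t = [] → q = []) := by
  choose c hc using fun i => (hψ.recognizable i).exists_bounded_completion
  obtain ⟨C, hC⟩ := (Set.finite_range c).bddAbove
  refine ⟨C, fun i u hu v hv huv t => ?_⟩
  obtain ⟨p, q, h, hp, hq, hpq⟩ := hc i u v ⟨hu, hv, huv⟩ t
  exact ⟨p, q, h, hp.trans (hC ⟨i, rfl⟩), hq.trans (hC ⟨i, rfl⟩), hpq⟩

/-- The lengths of the representatives of neighbouring elements differ by a bounded amount. -/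
theorem exists_length_le (hψ : IsCayleyAutomaticRep a L ψ) :
    ∃ c : ℕ, ∀ i, ∀ u ∈ L, ∀ v ∈ L, ψ u * a i = ψ v →
      v.length ≤ u.length + c ∧ u.length ≤ v.length + c := by
  obtain ⟨c, hc⟩ := hψ.exists_bounded_completion
  refine ⟨c, fun i u hu v hv huv => ⟨?_, ?_⟩⟩
  -- Cutting at `|u|` leaves `u` unchanged, so by injectivity of `ψ` the completed second word is
  -- `v` itself, with at most `c` letters after position `|u|`.
  · obtain ⟨p, q, ⟨hu', hv', h⟩, -, hq, hp', -⟩ := hc i u hu v hv huv u.length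
    rw [hp' List.drop_length, List.take_length, List.append_nil, huv] at h
    have h' := congrArg List.length (hψ.bijOn.injOn hv hv' h)
    rw [List.length_append, List.length_take] at h'
    omega
  · obtain ⟨p, q, ⟨hu', hv', h⟩, hp, -, -, hq'⟩ := hc i u hu v hv huv v.length
    rw [hq' List.drop_length, List.take_length, List.append_nil, ← huv] at h
    have h' := congrArg List.length (hψ.bijOn.injOn hu' hu (mul_right_cancel h))
    rw [List.length_append, List.length_take] at h'
    omega

/-- Along the path `w` from `1`, each letter changes the length of the representative by at most
`c`, starting from the representative `u₀` of `1`. -/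
theorem exists_length_le_linear (hψ : IsCayleyAutomaticRep a L ψ) :
    ∃ c : ℕ, ∀ w, ∀ u ∈ L, ψ u = proj a w → u.length ≤ c * (w.length + 1) := by
  obtain ⟨c, hc⟩ := hψ.exists_length_le
  obtain ⟨u₀, hu₀, h₀⟩ := hψ.bijOn.surjOn (Set.mem_univ (1 : G))
  suffices h : ∀ w, ∀ u ∈ L, ψ u = proj a w → u.length ≤ c * w.length + u₀.length by
    refine ⟨c + u₀.length, fun w u hu hw => (h w u hu hw).trans ?_⟩
    nlinarith [Nat.zero_le (u₀.length * w.length)]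
  intro w
  induction w using List.reverseRecOn with
  | nil =>
    intro u hu hw
    rw [hψ.bijOn.injOn hu hu₀ (hw.trans h₀.symm)]
    simp
  | append_singleton w s ih =>
    intro u hu hw
    obtain ⟨u', hu', h'⟩ := hψ.bijOn.surjOn (Set.mem_univ (proj a w))
    have hlen : u.length ≤ u'.length + c := by
      obtain ⟨i, b⟩ := s
      rw [proj_append, proj_singleton, ← h'] at hw
      cases b
      · exact (hc i u hu u' hu' (by rw [hw]; simp [letterVal])).2
      · exact (hc i u' hu' u hu (by rw [hw]; simp [letterVal])).1
    have := ih u' hu' h'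
    rw [List.length_append, List.length_singleton, mul_add, mul_one]
    omega

theorem isQuasigeodesic_appendLanguage (hψ : IsCayleyAutomaticRep a L ψ)
    (hgen : Subgroup.closure (Set.range a) = ⊤) (hv : IsGeodesicChoice a L ψ v) :
    IsQuasigeodesic a (appendLanguage L v) := by
  obtain ⟨c, hc⟩ := hψ.exists_length_le_linear
  refine ⟨((2 * c + 1 : ℕ) : ℝ), by positivity, ?_⟩
  rintro _ ⟨u, hu, rfl⟩
  rw [(hv u hu).1]
  obtain ⟨w, hw, hw'⟩ := exists_geodesic hgen 1 (ψ u)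
  rw [inv_one, one_mul] at hw
  have h₁ := hc w u hu hw.symm
  have h₂ := wordDist_triangle hgen (proj a u) 1 (ψ u)
  have h₃ : wordDist a 1 (proj a u) ≤ u.length := wordDist_le_length (one_mul _)
  rw [wordDist_comm hgen (proj a u) 1, ← (hv u hu).2] at h₂
  rw [hw'] at h₁
  -- With `d` the distance from `1` to `ψ u`, `|u| ≤ c(d + 1)` and `|v u| ≤ |u| + d`.
  have h₄ : (u ++ v u).length ≤ (2 * c + 1) * (wordDist a 1 (ψ u) + 1) := by
    rw [List.length_append]
    nlinarith
  exact_mod_cast h₄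

/-- Prefixes of representatives of neighbouring elements are close, up to the Cayley distance
function. -/
theorem exists_wordDist_take_le (hψ : IsCayleyAutomaticRep a L ψ)
    (hgen : Subgroup.closure (Set.range a) = ⊤) :
    ∃ c : ℕ, ∀ i, ∀ u₁ ∈ L, ∀ u₂ ∈ L, ψ u₁ * a i = ψ u₂ → ∀ t : ℕ,
      (wordDist a (proj a (u₁.take t)) (proj a (u₂.take t)) : ℝ) ≤
        2 * cayleyDistance a L ψ (t + c) + (2 * c + 1) := by
  obtain ⟨c, hc⟩ := hψ.exists_bounded_completion
  refine ⟨c, fun i u₁ hu₁ u₂ hu₂ h t => ?_⟩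
  obtain ⟨p, q, ⟨hp, hq, hpq⟩, hpc, hqc, -⟩ := hc i u₁ hu₁ u₂ hu₂ h t
  have side : ∀ (u r : List (Letter ι)), u.take t ++ r ∈ L → r.length ≤ c →
      (wordDist a (proj a (u.take t)) (ψ (u.take t ++ r)) : ℝ) ≤
        c + cayleyDistance a L ψ (t + c) := by
    intro u r hr hrc
    have h₁ := wordDist_triangle hgen (proj a (u.take t)) (proj a (u.take t ++ r))
      (ψ (u.take t ++ r))
    have h₂ : wordDist a (proj a (u.take t)) (proj a (u.take t ++ r)) ≤ r.length :=
      wordDist_le_length (proj_append _ _).symm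
    have h₃ : (wordDist a (ψ (u.take t ++ r)) (proj a (u.take t ++ r)) : ℝ) ≤
        cayleyDistance a L ψ (t + c) := by
      refine wordDist_le_cayleyDistance hr ?_
      rw [List.length_append, List.length_take]
      omega
    rw [wordDist_comm hgen] at h₃
    have h₄ : (wordDist a (proj a (u.take t)) (ψ (u.take t ++ r)) : ℝ) ≤
        c + wordDist a (proj a (u.take t ++ r)) (ψ (u.take t ++ r)) := by
      exact_mod_cast h₁.trans (Nat.add_le_add_right (h₂.trans hrc) _)
    linarith
  have h₁ := side u₁ p hp hpc
  have h₂ := side u₂ q hq hqc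
  have h₃ := wordDist_mul_gen_le (a := a) (ψ (u₁.take t ++ p)) i
  rw [hpq] at h₃
  rw [wordDist_comm hgen] at h₂
  have h₄ := wordDist_triangle hgen (proj a (u₁.take t)) (ψ (u₁.take t ++ p))
    (proj a (u₂.take t))
  have h₅ := wordDist_triangle hgen (ψ (u₁.take t ++ p)) (ψ (u₂.take t ++ q))
    (proj a (u₂.take t))
  rify at h₃ h₄ h₅
  linarith

/-- The prefixes differ only by letters of `v u`, which appear only when `|u| ≤ t`; then `|v u| ≤
h(t)`. -/
theorem wordDist_take_append_le (hgen : Subgroup.closure (Set.range a) = ⊤)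
    (hv : IsGeodesicChoice a L ψ v) {u : List (Letter ι)} (hu : u ∈ L) (t : ℕ) :
    (wordDist a (proj a (u.take t)) (proj a ((u ++ v u).take t)) : ℝ) ≤
      cayleyDistance a L ψ t := by
  have h₁ : wordDist a (proj a (u.take t)) (proj a ((u ++ v u).take t)) ≤
      ((v u).take (t - u.length)).length :=
    wordDist_le_length (by rw [List.take_append, proj_append])
  rw [List.length_take] at h₁
  rcases le_total u.length t with ht | ht
  · refine le_trans ?_ (wordDist_le_cayleyDistance (a := a) (ψ := ψ) hu ht)
    rw [wordDist_comm hgen (ψ u), ← (hv u hu).2]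
    exact_mod_cast h₁.trans (min_le_right _ _)
  · rw [Nat.sub_eq_zero_of_le ht, Nat.zero_min] at h₁
    rw [Nat.le_zero.1 h₁, Nat.cast_zero]
    exact cayleyDistance_nonneg t

theorem coarseLE_fellowDist (hψ : IsCayleyAutomaticRep a L ψ)
    (hgen : Subgroup.closure (Set.range a) = ⊤) (hnonauto : ¬ IsAutomatic a)
    (hv : IsGeodesicChoice a L ψ v) :
    CoarseLE (fellowDist a (appendLanguage L v)) (cayleyDistance a L ψ) := by
  obtain ⟨c, hc⟩ := hψ.exists_wordDist_take_le hgen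
  obtain ⟨n₀, hn₀⟩ := exists_one_le_cayleyDistance hgen hnonauto hψ
  -- For `n ≥ max c n₀`, `t + c ≤ 2n` and `h(2n) ≥ 1`, so `2h(t) + 2h(t + c) + 2c + 1 ≤ (2c +
  -- 5)h(2n)`.
  refine ⟨2 * c + 5, 2, max c n₀, by omega, by omega, fun n hn => ?_⟩
  have hone : 1 ≤ cayleyDistance a L ψ (2 * n) :=
    hn₀.trans (cayleyDistance_mono (by omega))
  have key : ∀ d : ℕ, (∃ t ≤ n, ∃ w₁ ∈ appendLanguage L v, ∃ w₂ ∈ appendLanguage L v, ∃ i : ι,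
      proj a w₁ * a i = proj a w₂ ∧
      d = wordDist a (proj a (w₁.take t)) (proj a (w₂.take t))) →
      (d : ℝ) ≤ ((2 * c + 5 : ℕ) : ℝ) * cayleyDistance a L ψ (2 * n) := by
    rintro d ⟨t, ht, _, ⟨u₁, hu₁, rfl⟩, _, ⟨u₂, hu₂, rfl⟩, i, hi, rfl⟩
    rw [(hv u₁ hu₁).1, (hv u₂ hu₂).1] at hi
    have h₁ := wordDist_take_append_le hgen hv hu₁ t
    have h₂ := wordDist_take_append_le hgen hv hu₂ t
    have h₃ := hc i u₁ hu₁ u₂ hu₂ hi t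
    have hm₁ : cayleyDistance a L ψ t ≤ cayleyDistance a L ψ (2 * n) :=
      cayleyDistance_mono (by omega)
    have hm₂ : cayleyDistance a L ψ (t + c) ≤ cayleyDistance a L ψ (2 * n) :=
      cayleyDistance_mono (by omega)
    rw [wordDist_comm hgen] at h₁
    have h₄ := wordDist_triangle hgen (proj a ((u₁ ++ v u₁).take t)) (proj a (u₁.take t))
      (proj a ((u₂ ++ v u₂).take t))
    have h₅ := wordDist_triangle hgen (proj a (u₁.take t)) (proj a (u₂.take t))
      (proj a ((u₂ ++ v u₂).take t))
    rify at h₄ h₅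
    push_cast
    nlinarith [mul_le_mul_of_nonneg_left hone (by positivity : (0 : ℝ) ≤ 2 * c + 1)]
  rw [fellowDist]
  -- The supremum is taken in `ℕ`, so the real bound passes through its floor.
  refine le_trans (Nat.cast_le.2 (csSup_le' fun d hd => Nat.le_floor (key d hd))) ?_
  exact Nat.floor_le (mul_nonneg (Nat.cast_nonneg _) (cayleyDistance_nonneg _))

end IsCayleyAutomaticRep

end FellowTraveler

theorem mainTheorem3 {ι G : Type*} [Finite ι] [Group G] (a : ι → G)
    (hgen : Subgroup.closure (Set.range a) = ⊤)
    (hnonauto : ¬ FellowTraveler.IsAutomatic a)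
    (L : Language (FellowTraveler.Letter ι)) (ψ : List (FellowTraveler.Letter ι) → G)
    (hψ : FellowTraveler.IsCayleyAutomaticRep a L ψ)
    (hh : FellowTraveler.MuchLess (FellowTraveler.cayleyDistance a L ψ) FellowTraveler.idFun) :
    (∃ v, FellowTraveler.IsGeodesicChoice a L ψ v) ∧
    ∀ v, FellowTraveler.IsGeodesicChoice a L ψ v →
      FellowTraveler.IsNormalForm a (FellowTraveler.appendLanguage L v) ∧
      FellowTraveler.IsQuasigeodesic a (FellowTraveler.appendLanguage L v) ∧
      FellowTraveler.FellowTravelerProperty a (FellowTraveler.appendLanguage L v)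
        (FellowTraveler.cayleyDistance a L ψ) := by
  refine ⟨FellowTraveler.exists_isGeodesicChoice hgen L ψ, fun v hv =>
    ⟨hψ.isNormalForm_appendLanguage hv, hψ.isQuasigeodesic_appendLanguage hgen hv, ?_⟩⟩
  exact ⟨FellowTraveler.cayleyDistance_mono, FellowTraveler.cayleyDistance_nonneg, hh,
    hψ.coarseLE_fellowDist hgen hnonauto hv⟩
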